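/- **Setting.** Let $P$ be the plant $x(n+1)=Ax(n)+B_1d(n)+B_2u(n)$, $e(n)=C_1x(n)+D_{11}d(n)+D_{12}u(n)$, $y(n)=C_2x(n)+D_{21}d(n)$, with scalar $u$ and $y$, and let $F$ and $L=[L_w,L_y]$ be proper finite-dimensional LTI filters, closed in the loop $$u=Fw,\qquad v=L_wz^{-1}w+L_yy,\qquad w=v+q ,$$ which is internally stable. The initial plant state $x(0)$ and the disturbance $d$ are jointly Gaussian, $d$ is zero-mean and white with identity covariance, the filters start from arbitrary fixed states, and $q$ is zero-mean Gaussian white noise of variance $\sigma_q^2>0$, independent of $(x(0),d)$; hence $v$ is Gaussian. Let $\sigma_v^2=\lim_n\operatorname{Var}v(n)$ and $\gamma=\sigma_v^2/\sigma_q^2$; this system is denoted $(F,L,P,\gamma)$. Let $P_{21}$ and $P_{22}$ be the transfer functions of $P$ from $d$ and from $u$ to $y$, let $S=(1-L_wz^{-1}-P_{22}FL_y)^{-1}$, and let $\|\cdot\|$ be the $H_2$ norm. Assume $S\neq1$ and $\gamma>\|S-1\|^2$, where $\|S-1\|^2$ is the minimum signal-to-noise ratio (SNR) required for stability. Let $1\le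 k'\le k$ and let $y_i=v+q_i$, $i=1,\dots,k$, where the noises $q_1,\dots,q_k$ are mutually independent, jointly independent of $(x(0),d)$, zero-mean, white, and of common variance $\sigma^2\in(0,\infty)$ (they need not be Gaussian). The $y_i$ form a *$(k,k')$ stabilizing code* for $(F,L,P,\gamma)$ if, whichever $k'$ of them are received at each time, closing the loop with $w=$ the average of the received $y_i$ makes the plant mean-square stable, i.e. $\sup_n\mathbb E[x(n)x(n)^T]<\infty$. **Lemma.** Suppose that $$\sigma^2\le\frac{\gamma\,k'\,\|L_yP_{21}S\|^2}{\|S-1\|^2\,(\gamma-\|S-1\|^2)} .$$ Then: 1. the $y_i$, $i=1,\dots,k$, form a $(k,k')$ stabilizing code for $(F,L,P,\gamma)$; 2. for the signal $v$ of $(F,L,P,\gamma)$, the average of any $k'$ of the $y_i$ has SNR $\sigma_v^2/\operatorname{Var}\big(\tfrac1{k'}\sum_{j=1}^{k'}q_{i_j}\big)\ge\|S-1\|^2$, with strict inequality if the bound on $\sigma^2$ is strict; 3. in the loop closed with the average of any $k'$ of the $y_i$ (the set of received indices may vary with time in any fixed way), $v$ has a steady-state variance, and the resulting steady-state SNR is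 strictly greater than $\|S-1\|^2$. -/

import Mathlib

open MeasureTheory ProbabilityTheory Filter Topology
open scoped PowerSeries Matrix

noncomputable section

/-! ## The linear system: plant `P`, filters `F` and `L` -/

/-- The plant
`x(i+1) = A x(i) + B₁ d(i) + B₂ u(i)`, `e(i) = C₁ x(i) + D₁₁ d(i) + D₁₂ u(i)`,
`y(i) = C₂ x(i) + D₂₁ d(i)`, with scalar control input `u` and scalar sensor output `y`. -/
structure Plant (nx nd ne : ℕ) where
  A : Matrix (Fin nx) (Fin nx) ℝ
  B₁ : Matrix (Fin nx) (Fin nd) ℝ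
  B₂ : Fin nx → ℝ
  C₁ : Matrix (Fin ne) (Fin nx) ℝ
  C₂ : Fin nx → ℝ
  D₁₁ : Matrix (Fin ne) (Fin nd) ℝ
  D₁₂ : Fin ne → ℝ
  D₂₁ : Fin nd → ℝ

/-- The proper LTI filter `F` from `w` to `u`, in state-space form:
`x_F(i+1) = A x_F(i) + B w(i)`, `u(i) = C x_F(i) + D w(i)`. -/
structure DecoderFilter (nf : ℕ) where
  A : Matrix (Fin nf) (Fin nf) ℝ
  B : Fin nf → ℝ
  C : Fin nf → ℝ
  D : ℝ

/-- The proper LTI filter `L = [L_w, L_y]` from `(z⁻¹ w, y)` to `v`, in state-space form: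
`x_L(i+1) = A x_L(i) + B_w w(i-1) + B_y y(i)`, `v(i) = C x_L(i) + D_w w(i-1) + D_y y(i)`. -/
structure EncoderFilter (nl : ℕ) where
  A : Matrix (Fin nl) (Fin nl) ℝ
  Bw : Fin nl → ℝ
  By : Fin nl → ℝ
  C : Fin nl → ℝ
  Dw : ℝ
  Dy : ℝ

/-- State of the closed loop: the states of the plant and of the two filters, and the content
`w(i-1)` of the one-step delay. -/
structure LoopState (nx nf nl : ℕ) where
  plant : Fin nx → ℝ
  dec : Fin nf → ℝ
  enc : Fin nl → ℝ
  wPrev : ℝ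

section Loop

variable {nx nd ne nf nl : ℕ}

/-- The sensor output `y = C₂ x + D₂₁ d`. -/
def sensorOutput (P : Plant nx nd ne) (x : Fin nx → ℝ) (d : Fin nd → ℝ) : ℝ :=
  P.C₂ ⬝ᵥ x + P.D₂₁ ⬝ᵥ d

/-- The encoder signal `v = L [z⁻¹ w; y]`. -/
def encoderOutput (P : Plant nx nd ne) (L : EncoderFilter nl) (s : LoopState nx nf nl)
    (d : Fin nd → ℝ) : ℝ :=
  L.C ⬝ᵥ s.enc + L.Dw * s.wPrev + L.Dy * sensorOutput P s.plant d

/-- The control signal `u = F w`. -/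
def controlInput (F : DecoderFilter nf) (s : LoopState nx nf nl) (w : ℝ) : ℝ :=
  F.C ⬝ᵥ s.dec + F.D * w

/-- One time step of the loop, when the disturbance is `d` and `w` is fed to `F` and to the
delay. -/
def loopStep (P : Plant nx nd ne) (F : DecoderFilter nf) (L : EncoderFilter nl)
    (s : LoopState nx nf nl) (d : Fin nd → ℝ) (w : ℝ) : LoopState nx nf nl where
  plant := P.A *ᵥ s.plant + P.B₁ *ᵥ d + controlInput F s w • P.B₂
  dec := F.A *ᵥ s.dec + w • F.B
  enc := L.A *ᵥ s.enc + s.wPrev • L.Bw + sensorOutput P s.plant d • L.By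
  wPrev := w

/-- The trajectory of the loop from the state `s₀`, with disturbance `d`, when at each time `n`
the signal `w(n)` is obtained from `v(n)` through the map `chan n`: `w(n) = chan n (v(n))`. -/
def loopState (P : Plant nx nd ne) (F : DecoderFilter nf) (L : EncoderFilter nl)
    (s₀ : LoopState nx nf nl) (d : ℕ → Fin nd → ℝ) (chan : ℕ → ℝ → ℝ) :
    ℕ → LoopState nx nf nl
  | 0 => s₀
  | n + 1 =>
    let s := loopState P F L s₀ d chan n
    loopStep P F L s (d n) (chan n (encoderOutput P L s (d n)))

/-- The signal `v(n)` along the trajectory. -/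
def loopSignal (P : Plant nx nd ne) (F : DecoderFilter nf) (L : EncoderFilter nl)
    (s₀ : LoopState nx nf nl) (d : ℕ → Fin nd → ℝ) (chan : ℕ → ℝ → ℝ) (n : ℕ) : ℝ :=
  encoderOutput P L (loopState P F L s₀ d chan n) (d n)

/-- Internal stability: without disturbance and coding noise (`d = 0`, `w = v`), the state of the
loop tends to `0` from every initial state. The loop is well-posed by construction, as
`P₂₂` is strictly proper. -/
def InternallyStable (P : Plant nx nd ne) (F : DecoderFilter nf) (L : EncoderFilter nl) : Prop :=
  ∀ s₀ : LoopState nx nf nl,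
    Tendsto (fun n => (loopState P F L s₀ 0 (fun _ v => v) n).plant) atTop (𝓝 0) ∧
    Tendsto (fun n => (loopState P F L s₀ 0 (fun _ v => v) n).dec) atTop (𝓝 0) ∧
    Tendsto (fun n => (loopState P F L s₀ 0 (fun _ v => v) n).enc) atTop (𝓝 0) ∧
    Tendsto (fun n => (loopState P F L s₀ 0 (fun _ v => v) n).wPrev) atTop (𝓝 0)

end Loop

/-! ## Transfer functions, as power series in `X = z⁻¹` -/

/-- The transfer function `D + C (z - A)⁻¹ B = D + ∑ₙ C Aⁿ B z⁻⁽ⁿ⁺¹⁾`. -/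
def transfer {m : ℕ} (A : Matrix (Fin m) (Fin m) ℝ) (B C : Fin m → ℝ) (D : ℝ) : ℝ⟦X⟧ :=
  PowerSeries.mk fun
    | 0 => D
    | n + 1 => C ⬝ᵥ ((A ^ n) *ᵥ B)

/-- The squared (`H₂`) norm of a causal transfer function: the energy of its impulse response.
By Parseval, this is `(1/2π) ∫ |G(e^{iθ})|² dθ` when `G` is stable. -/
def normSq (G : ℝ⟦X⟧) : ℝ := ∑' n, (PowerSeries.coeff n G) ^ 2

section Transfer

variable {nx nd ne nf nl : ℕ}

/-- `P₂₁`, from the `j`-th component of `d` to `y`. -/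
def Plant.P₂₁ (P : Plant nx nd ne) (j : Fin nd) : ℝ⟦X⟧ :=
  transfer P.A (fun i => P.B₁ i j) P.C₂ (P.D₂₁ j)

/-- `P₂₂`, from `u` to `y`. -/
def Plant.P₂₂ (P : Plant nx nd ne) : ℝ⟦X⟧ := transfer P.A P.B₂ P.C₂ 0

/-- The transfer function of `F`. -/
def DecoderFilter.tf (F : DecoderFilter nf) : ℝ⟦X⟧ := transfer F.A F.B F.C F.D

/-- `L_w`. -/
def EncoderFilter.Lw (L : EncoderFilter nl) : ℝ⟦X⟧ := transfer L.A L.Bw L.C L.Dw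

/-- `L_y`. -/
def EncoderFilter.Ly (L : EncoderFilter nl) : ℝ⟦X⟧ := transfer L.A L.By L.C L.Dy

/-- `S = (1 - L_w z⁻¹ - P₂₂ F L_y)⁻¹`. The series that is inverted has constant coefficient `1`. -/
def sensitivity (P : Plant nx nd ne) (F : DecoderFilter nf) (L : EncoderFilter nl) : ℝ⟦X⟧ :=
  (1 - L.Lw * PowerSeries.X - P.P₂₂ * F.tf * L.Ly)⁻¹

/-- `‖S - 1‖²`, the minimum signal-to-noise ratio required for stability. -/
def minSNR (P : Plant nx nd ne) (F : DecoderFilter nf) (L : EncoderFilter nl) : ℝ :=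
  normSq (sensitivity P F L - 1)

/-- `‖L_y P₂₁ S‖²`, summed over the components of `d`. -/
def disturbanceGain (P : Plant nx nd ne) (F : DecoderFilter nf) (L : EncoderFilter nl) : ℝ :=
  ∑ j, normSq (L.Ly * P.P₂₁ j * sensitivity P F L)

end Transfer

/-! ## Random signals -/

section Random

variable {Ω : Type*} [MeasurableSpace Ω]

/-- The initial plant state `x₀` and the disturbance `d` are jointly Gaussian, and `d` is
zero-mean and white with identity covariance. -/
structure GaussianSources {nx nd : ℕ} (μ : Measure Ω) (x₀ : Ω → Fin nx → ℝ)
    (d : ℕ → Ω → Fin nd → ℝ) : Prop where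
  gaussian : IsGaussianProcess
    (Sum.elim (fun (i : Fin nx) ω => x₀ ω i) (fun (p : ℕ × Fin nd) ω => d p.1 ω p.2)) μ
  mean_zero : ∀ n j, ∫ ω, d n ω j ∂μ = 0
  white : ∀ m n i j, ∫ ω, d m ω i * d n ω j ∂μ = if m = n ∧ i = j then 1 else 0

/-- `q` is zero-mean white noise with variance `σ2`. -/
structure WhiteNoise (μ : Measure Ω) (q : ℕ → Ω → ℝ) (σ2 : ℝ) : Prop where
  memLp : ∀ n, MemLp (q n) 2 μ
  mean_zero : ∀ n, ∫ ω, q n ω ∂μ = 0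
  white : ∀ m n, ∫ ω, q m ω * q n ω ∂μ = if m = n then σ2 else 0

variable {nx nd ne nf nl : ℕ}

/-- The linear system `(F, L, P, γ)`: an internally stable loop, driven by Gaussian sources and by
Gaussian white coding noise `q` with variance `σq2`, independent of the sources, in
which `w = v + q` and the signal-to-noise ratio is `γ = σ_v² / σ_q²`, where `σv2` is the steady
state variance of `v`. As an affine function of jointly Gaussian variables, `v` is Gaussian. -/
structure IsLinearSystem (P : Plant nx nd ne) (F : DecoderFilter nf) (L : EncoderFilter nl)
    (γ : ℝ) (μ : Measure Ω) (s₀ : Ω → LoopState nx nf nl) (d : ℕ → Ω → Fin nd → ℝ)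
    (q : ℕ → Ω → ℝ) (σv2 σq2 : ℝ) : Prop where
  stable : InternallyStable P F L
  sources : GaussianSources μ (fun ω => (s₀ ω).plant) d
  filters_init : ∃ (f₀ : Fin nf → ℝ) (l₀ : Fin nl → ℝ) (w₀ : ℝ), ∀ ω,
    (s₀ ω).dec = f₀ ∧ (s₀ ω).enc = l₀ ∧ (s₀ ω).wPrev = w₀
  noise_white : WhiteNoise μ q σq2
  noise_gaussian : IsGaussianProcess q μ
  noise_indep : IndepFun (fun ω => ((s₀ ω).plant, fun n => d n ω)) (fun ω n => q n ω) μ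
  noise_pos : 0 < σq2
  steady_state : Tendsto
    (fun n => Var[fun ω => loopSignal P F L (s₀ ω) (fun m => d m ω) (fun m v => v + q m ω) n; μ])
    atTop (𝓝 σv2)
  snr_eq : γ = σv2 / σq2

/-- The `i`-th description `y_i = v + q_i` of `v`, at time `n`. -/
def description {k : ℕ} (q : Fin k → ℕ → Ω → ℝ) (i : Fin k) (n : ℕ) (ω : Ω) (v : ℝ) : ℝ :=
  v + q i n ω

/-- The average, at time `n`, of the received descriptions; `I` is the set of their indices. -/
def received {k : ℕ} (q : Fin k → ℕ → Ω → ℝ) (I : Finset (Fin k)) (n : ℕ) (ω : Ω) (v : ℝ) : ℝ :=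
  (∑ i ∈ I, description q i n ω v) / (I.card : ℝ)

/-- The state of the loop at time `n` when it is closed over the erasure channel: at time `m`, the
descriptions with index in `I m` are received, and `w(m)` is their average. -/
def codedState (P : Plant nx nd ne) (F : DecoderFilter nf) (L : EncoderFilter nl) {k : ℕ}
    (s₀ : Ω → LoopState nx nf nl) (d : ℕ → Ω → Fin nd → ℝ) (q : Fin k → ℕ → Ω → ℝ)
    (I : ℕ → Finset (Fin k)) (n : ℕ) (ω : Ω) : LoopState nx nf nl :=
  loopState P F L (s₀ ω) (fun m => d m ω) (fun m v => received q (I m) m ω v) n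

/-- The signal `v(n)` in the loop that is closed over the erasure channel. -/
def codedSignal (P : Plant nx nd ne) (F : DecoderFilter nf) (L : EncoderFilter nl) {k : ℕ}
    (s₀ : Ω → LoopState nx nf nl) (d : ℕ → Ω → Fin nd → ℝ) (q : Fin k → ℕ → Ω → ℝ)
    (I : ℕ → Finset (Fin k)) (n : ℕ) (ω : Ω) : ℝ :=
  loopSignal P F L (s₀ ω) (fun m => d m ω) (fun m v => received q (I m) m ω v) n

/-- Mean-square stability of a random vector process: `sup_n E[x(n) x(n)ᵀ] < ∞`, entrywise. -/
def MeanSquareStable {m : ℕ} (μ : Measure Ω) (x : ℕ → Ω → Fin m → ℝ) : Prop :=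
  (∀ n i, MemLp (fun ω => x n ω i) 2 μ) ∧
    ∃ C : ℝ, ∀ n i j, |∫ ω, x n ω i * x n ω j ∂μ| ≤ C

/-- The descriptions `y_i = v + q_i`, `i = 1, …, k`, form a `(k, k')` stabilizing code: whichever
`k'` of them are received at each time, using them makes the plant mean-square stable. -/
def IsStabilizingCode (P : Plant nx nd ne) (F : DecoderFilter nf) (L : EncoderFilter nl)
    {k : ℕ} (k' : ℕ) (μ : Measure Ω) (s₀ : Ω → LoopState nx nf nl) (d : ℕ → Ω → Fin nd → ℝ)
    (q : Fin k → ℕ → Ω → ℝ) : Prop :=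
  ∀ I : ℕ → Finset (Fin k), (∀ n, (I n).card = k') →
    MeanSquareStable μ (fun n ω => (codedState P F L s₀ d q I n ω).plant)

end Random

end

/-!
Closed with `w = v + r`, the loop is a linear system `x⁺ = A x + B_d d + B_r r` whose output is `v`.
Internal stability says that the powers of `A` tend to `0` pointwise; in finite dimension this makes
`∑ ‖Aⁿ‖` finite (`summable_norm_pow_of_pointwise`). So the plant state is mean-square bounded for any
inputs that are bounded in mean square, and the initial state contributes nothing to the variance of
`v` in the limit, even if it is correlated with the disturbance.

Writing the loop equations for the generating series of the signals gives
`V = (S - 1) R + L_y P₂₁ S D` (`mk_loopSignal`): the impulse responses of `v` are the coefficients of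
`S - 1` and of `L_y P₂₁ S`. Hence a white noise `r` of variance `τ`, uncorrelated with `d`, gives `v`
the steady-state variance `‖S - 1‖² τ + G` with `G = ‖L_y P₂₁ S‖²`
(`WhiteInputs.tendsto_variance_loopSignal`); only second moments of `r` matter.

For the noise of the system `(F, L, P, γ)` this reads `σ_v² = ‖S - 1‖² σ_q² + G`, so
`G = (γ - ‖S - 1‖²) σ_q²`, which is positive, and the bound on `σ²` becomes
`σ² ≤ k' σ_v² / ‖S - 1‖²`. The average of any `k'` descriptions is `v` plus white noise of variance
`σ² / k'` (`whiteNoise_averageNoise`), so its signal-to-noise ratio is `k' σ_v² / σ² ≥ ‖S - 1‖²`. The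
loop closed with it is again a loop with white noise; its plant is mean-square stable, and its
steady-state signal-to-noise ratio is `‖S - 1‖² + k' G / σ² > ‖S - 1‖²`.
-/

/-! ### Linear recursions and power-stable operators -/

/-- The solution of a driven linear recursion: the response to the initial state plus the
convolution of the drive with the powers of `a`. -/
theorem linear_recursion_solution {M E : Type*} [Monoid M] [AddCommMonoid E]
    [DistribMulAction M E] (a : M) (f x : ℕ → E) (hx : ∀ n, x (n + 1) = a • x n + f n) (n : ℕ) :
    x n = a ^ n • x 0 + ∑ k ∈ Finset.range n, a ^ k • f (n - 1 - k) := by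
  induction n with
  | zero => simp
  | succ n ih =>
    rw [hx, ih, smul_add, ← mul_smul, ← pow_succ', add_assoc, Finset.sum_range_succ',
      Finset.smul_sum]
    congr 2
    · refine Finset.sum_congr rfl fun k _ => ?_
      rw [← mul_smul, ← pow_succ']
      congr 2
      omega
    · simp

/-- In finite dimension, pointwise convergence of operators to `0` is convergence in norm. -/
theorem tendsto_norm_zero_of_pointwise {E : Type*} [NormedAddCommGroup E] [NormedSpace ℝ E]
    [FiniteDimensional ℝ E] (T : ℕ → E →L[ℝ] E) (hT : ∀ x, Tendsto (fun n => T n x) atTop (𝓝 0)) :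
    Tendsto (fun n => ‖T n‖) atTop (𝓝 0) := by
  let b := Module.finBasis ℝ E
  obtain ⟨C, hC, h⟩ := b.exists_opNorm_le (F := E)
  have hs : Tendsto (fun n => C * ∑ i, ‖T n (b i)‖) atTop (𝓝 0) := by
    have := tendsto_finsetSum Finset.univ fun i _ => (hT (b i)).norm
    simpa using this.const_mul C
  refine squeeze_zero (fun n => norm_nonneg _) (fun n => ?_) hs
  refine h (by positivity) fun i => ?_
  exact Finset.single_le_sum (f := fun i => ‖T n (b i)‖) (fun _ _ => norm_nonneg _)
    (Finset.mem_univ i)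

/-- A finite-dimensional operator whose powers tend to `0` pointwise has summable powers: some power
has norm at most `1/2`, so the partial sums satisfy `s ≤ c + s / 2`. -/
theorem summable_norm_pow_of_pointwise {E : Type*} [NormedAddCommGroup E] [NormedSpace ℝ E]
    [FiniteDimensional ℝ E] (a : E →L[ℝ] E)
    (ha : ∀ x, Tendsto (fun n => (a ^ n) x) atTop (𝓝 0)) : Summable fun n => ‖a ^ n‖ := by
  have h0 := tendsto_norm_zero_of_pointwise _ ha
  obtain ⟨N, hN⟩ := (h0.eventually_le_const (show (0 : ℝ) < 1 / 2 by norm_num)).exists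
  refine summable_of_sum_range_le (c := 2 * ∑ n ∈ Finset.range N, ‖a ^ n‖)
    (fun n => norm_nonneg _) fun K => ?_
  have h1 : ∑ n ∈ Finset.range K, ‖a ^ n‖ ≤ ∑ n ∈ Finset.range (N + K), ‖a ^ n‖ :=
    Finset.sum_le_sum_of_subset_of_nonneg (by simp) fun _ _ _ => norm_nonneg _
  have h2 : ∑ n ∈ Finset.range K, ‖a ^ (N + n)‖ ≤ ∑ n ∈ Finset.range K, 1 / 2 * ‖a ^ n‖ := by
    refine Finset.sum_le_sum fun n _ => ?_
    rw [pow_add]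
    exact (norm_mul_le _ _).trans (by gcongr)
  rw [Finset.sum_range_add] at h1
  rw [← Finset.mul_sum] at h2
  linarith

/-! ### Transfer functions act on signals -/

/-- A state-space system with two scalar inputs, started at rest, acts on generating series of
signals as multiplication by its transfer functions. -/
theorem mk_output_eq_transfer_mul {m : ℕ} (A : Matrix (Fin m) (Fin m) ℝ) (B B' C : Fin m → ℝ)
    (D D' : ℝ) (a b : ℕ → ℝ) (x : ℕ → Fin m → ℝ) (h0 : x 0 = 0)
    (hx : ∀ n, x (n + 1) = A *ᵥ x n + (a n • B + b n • B')) :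
    PowerSeries.mk (fun n => C ⬝ᵥ x n + D * a n + D' * b n) =
      transfer A B C D * PowerSeries.mk a + transfer A B' C D' * PowerSeries.mk b := by
  have hsol := linear_recursion_solution (Matrix.toLin' A : Module.End ℝ (Fin m → ℝ))
    (fun n => a n • B + b n • B') x (fun n => by simp [hx n, Module.End.smul_def])
  ext n
  simp only [map_add, PowerSeries.coeff_mk, PowerSeries.coeff_mul,
    Finset.Nat.sum_antidiagonal_eq_sum_range_succ_mk, transfer]
  rw [Finset.sum_range_succ', Finset.sum_range_succ', hsol n, h0]
  simp only [smul_zero, zero_add, Module.End.smul_def, dotProduct_sum, ← Matrix.toLin'_pow,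
    Matrix.toLin'_apply, Matrix.mulVec_add, Matrix.mulVec_smul, dotProduct_add, dotProduct_smul,
    smul_eq_mul, Finset.sum_add_distrib, Nat.sub_zero]
  have e : ∀ k, n - 1 - k = n - (k + 1) := fun k => by omega
  simp only [e, mul_comm (a _) (_ ⬝ᵥ _), mul_comm (b _) (_ ⬝ᵥ _)]
  ring

section Loop

variable {nx nd ne nf nl : ℕ}

/-! ### The closed loop as one linear system -/

/-- The state space of the loop as a normed space: plant, decoder, encoder, delay. -/
abbrev LoopVec (nx nf nl : ℕ) : Type :=
  (Fin nx → ℝ) × (Fin nf → ℝ) × (Fin nl → ℝ) × ℝ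

/-- A loop state as an element of the normed space `LoopVec`. -/
def LoopState.toVec (s : LoopState nx nf nl) : LoopVec nx nf nl :=
  (s.plant, s.dec, s.enc, s.wPrev)

/-- The loop state with the given coordinates. -/
def LoopState.ofVec (x : LoopVec nx nf nl) : LoopState nx nf nl :=
  ⟨x.1, x.2.1, x.2.2.1, x.2.2.2⟩

theorem LoopState.toVec_ofVec (x : LoopVec nx nf nl) :
    (LoopState.ofVec x).toVec = x := rfl

variable (P : Plant nx nd ne) (F : DecoderFilter nf) (L : EncoderFilter nl)

/-- The closed-loop transition `x ↦ x⁺` with `w = v` and no disturbance. -/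
noncomputable def closedLoopOp : LoopVec nx nf nl →L[ℝ] LoopVec nx nf nl :=
  LinearMap.toContinuousLinearMap
    { toFun := fun x => (loopStep P F L (.ofVec x) 0 (encoderOutput P L (.ofVec x) 0)).toVec
      map_add' := fun x y => by
        simp [loopStep, encoderOutput, controlInput, sensorOutput, LoopState.ofVec,
          LoopState.toVec, Matrix.mulVec_add]
        refine ⟨?_, ?_, ?_, ?_⟩ <;> first | module | ring
      map_smul' := fun c x => by
        simp [loopStep, encoderOutput, controlInput, sensorOutput, LoopState.ofVec,
          LoopState.toVec, Matrix.mulVec_smul]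
        refine ⟨?_, ?_, ?_, ?_⟩ <;> first | module | ring }

/-- The map from the disturbance to the next state of the loop closed with `w = v`. -/
noncomputable def disturbanceOp : (Fin nd → ℝ) →L[ℝ] LoopVec nx nf nl :=
  LinearMap.toContinuousLinearMap
    { toFun := fun d => (loopStep P F L (.ofVec 0) d
        (encoderOutput (nf := nf) P L (.ofVec 0) d)).toVec
      map_add' := fun x y => by
        simp [loopStep, encoderOutput, controlInput, sensorOutput, LoopState.ofVec,
          LoopState.toVec, Matrix.mulVec_add]
        refine ⟨?_, ?_, ?_, ?_⟩ <;> first | module | ring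
      map_smul' := fun c x => by
        simp [loopStep, encoderOutput, controlInput, sensorOutput, LoopState.ofVec,
          LoopState.toVec, Matrix.mulVec_smul]
        refine ⟨?_, ?_, ?_, ?_⟩ <;> first | module | ring }

/-- The direction in which the channel noise `q` enters the state of the loop. -/
noncomputable def noiseDir : LoopVec nx nf nl := (F.D • P.B₂, F.B, 0, 1)

/-- The encoder signal as a functional of the state, without disturbance. -/
noncomputable def signalOp : LoopVec nx nf nl →L[ℝ] ℝ :=
  LinearMap.toContinuousLinearMap
    { toFun := fun x => encoderOutput P L (.ofVec x : LoopState nx nf nl) 0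
      map_add' := fun x y => by
        simp [encoderOutput, sensorOutput, LoopState.ofVec]
        ring
      map_smul' := fun c x => by
        simp [encoderOutput, sensorOutput, LoopState.ofVec]
        ring }

theorem encoderOutput_eq (s : LoopState nx nf nl) (d : Fin nd → ℝ) :
    encoderOutput P L s d = signalOp P L s.toVec + L.Dy * (P.D₂₁ ⬝ᵥ d) := by
  simp [signalOp, encoderOutput, sensorOutput, LoopState.ofVec, LoopState.toVec]
  ring

theorem toVec_loopStep (s : LoopState nx nf nl) (d : Fin nd → ℝ) (r : ℝ) :
    (loopStep P F L s d (encoderOutput P L s d + r)).toVec =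
      closedLoopOp P F L s.toVec + (disturbanceOp P F L d + r • noiseDir P F) := by
  simp [closedLoopOp, disturbanceOp, noiseDir, loopStep, encoderOutput, controlInput,
    sensorOutput, LoopState.ofVec, LoopState.toVec]
  refine ⟨?_, ?_, ?_, ?_⟩ <;> first | module | ring

theorem toVec_loopState_succ (s₀ : LoopState nx nf nl) (d : ℕ → Fin nd → ℝ) (r : ℕ → ℝ)
    (n : ℕ) :
    (loopState P F L s₀ d (fun m v => v + r m) (n + 1)).toVec =
      closedLoopOp P F L (loopState P F L s₀ d (fun m v => v + r m) n).toVec +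
        (disturbanceOp P F L (d n) + r n • noiseDir P F) :=
  toVec_loopStep ..

theorem toVec_loopState (s₀ : LoopState nx nf nl) (d : ℕ → Fin nd → ℝ) (r : ℕ → ℝ) (n : ℕ) :
    (loopState P F L s₀ d (fun m v => v + r m) n).toVec =
      (closedLoopOp P F L ^ n) s₀.toVec + ∑ k ∈ Finset.range n, (closedLoopOp P F L ^ k)
        (disturbanceOp P F L (d (n - 1 - k)) + r (n - 1 - k) • noiseDir P F) :=
  linear_recursion_solution (closedLoopOp P F L)
    (fun n => disturbanceOp P F L (d n) + r n • noiseDir P F)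
    (fun n => (loopState P F L s₀ d (fun m v => v + r m) n).toVec)
    (fun n => toVec_loopState_succ P F L s₀ d r n) n

theorem InternallyStable.summable_norm_pow {P : Plant nx nd ne} {F : DecoderFilter nf}
    {L : EncoderFilter nl} (h : InternallyStable P F L) :
    Summable fun n => ‖closedLoopOp P F L ^ n‖ := by
  refine summable_norm_pow_of_pointwise _ fun x => ?_
  have hx : ∀ n, (closedLoopOp P F L ^ n) x =
      (loopState P F L (.ofVec x) 0 (fun _ v => v) n).toVec := fun n => by
    have := toVec_loopState P F L (.ofVec x) 0 0 n
    simpa [LoopState.toVec_ofVec] using this.symm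
  obtain ⟨h1, h2, h3, h4⟩ := h (.ofVec x)
  simp only [hx]
  exact h1.prodMk_nhds (h2.prodMk_nhds (h3.prodMk_nhds h4))

/-! ### Impulse responses of the loop -/

/-- The response of `v` to an impulse in the channel noise, encoded as the coefficients of `S - 1`;
`noiseImpulse_succ` expresses it through the state space. -/
noncomputable def noiseImpulse (n : ℕ) : ℝ := PowerSeries.coeff n (sensitivity P F L - 1)

/-- The response of `v` to an impulse in the `j`-th component of the disturbance, encoded as the
coefficients of `L_y P₂₁ S`. -/
noncomputable def disturbanceImpulse (j : Fin nd) (n : ℕ) : ℝ :=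
  PowerSeries.coeff n (L.Ly * P.P₂₁ j * sensitivity P F L)

/-- The loop equation for generating series: from rest, `V = (S - 1) R + L_y P₂₁ S D`, where the
disturbance `D` is scalar and acts in the direction `e`, and `P₂₁` is taken in that direction. -/
theorem mk_loopSignal (e : Fin nd → ℝ) (δ r : ℕ → ℝ) :
    PowerSeries.mk (loopSignal P F L (.ofVec 0 : LoopState nx nf nl)
      (fun m => δ m • e) (fun m v => v + r m)) =
      (sensitivity P F L - 1) * PowerSeries.mk r +
        L.Ly * transfer P.A (P.B₁ *ᵥ e) P.C₂ (P.D₂₁ ⬝ᵥ e) * sensitivity P F L * PowerSeries.mk δ := by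
  set s := loopState P F L (.ofVec 0 : LoopState nx nf nl)
      (fun m => δ m • e) (fun m v => v + r m) with hs
  set v := loopSignal P F L (.ofVec 0 : LoopState nx nf nl)
      (fun m => δ m • e) (fun m v => v + r m) with hv
  set w : ℕ → ℝ := fun n => v n + r n with hw
  set y : ℕ → ℝ := fun n => sensorOutput P (s n).plant (δ n • e) with hy
  set u : ℕ → ℝ := fun n => controlInput F (s n) (w n) with hu
  have hstep : ∀ n, s (n + 1) = loopStep P F L (s n) (δ n • e) (w n) := fun n => rfl
  have hU : PowerSeries.mk u = F.tf * PowerSeries.mk w := by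
    have := mk_output_eq_transfer_mul F.A F.B 0 F.C F.D 0 w 0 (fun n => (s n).dec) rfl
      (fun n => by simp [hstep, loopStep])
    have h0 : (PowerSeries.mk (0 : ℕ → ℝ)) = 0 := by ext n; simp
    rw [h0, mul_zero, add_zero] at this
    simpa [DecoderFilter.tf, hu, controlInput] using this
  have hY : PowerSeries.mk y = transfer P.A (P.B₁ *ᵥ e) P.C₂ (P.D₂₁ ⬝ᵥ e) * PowerSeries.mk δ +
      P.P₂₂ * PowerSeries.mk u := by
    have := mk_output_eq_transfer_mul P.A (P.B₁ *ᵥ e) P.B₂ P.C₂ (P.D₂₁ ⬝ᵥ e) 0 δ u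
      (fun n => (s n).plant) rfl (fun n => by
        simp [hstep, loopStep, hu, add_assoc, Matrix.mulVec_smul])
    rw [Plant.P₂₂, ← this]
    congr 1
    funext n
    simp [hy, sensorOutput, mul_comm]
  have hV : PowerSeries.mk v =
      L.Lw * (PowerSeries.X * PowerSeries.mk w) + L.Ly * PowerSeries.mk y := by
    have := mk_output_eq_transfer_mul L.A L.Bw L.By L.C L.Dw L.Dy (fun n => (s n).wPrev) y
      (fun n => (s n).enc) rfl (fun n => by simp [hstep, loopStep, hy, add_assoc])
    have hX : PowerSeries.mk (fun n => (s n).wPrev) = PowerSeries.X * PowerSeries.mk w := by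
      ext n
      cases n with
      | zero => simp [hs, loopState, LoopState.ofVec]
      | succ n => simp [PowerSeries.coeff_succ_X_mul, hstep, loopStep]
    rw [EncoderFilter.Lw, EncoderFilter.Ly, ← hX, ← this]
    rfl
  have hW : PowerSeries.mk w = PowerSeries.mk v + PowerSeries.mk r := by
    ext n; simp [hw]
  have hinv : (1 - L.Lw * PowerSeries.X - P.P₂₂ * F.tf * L.Ly) * sensitivity P F L = 1 :=
    PowerSeries.mul_inv_cancel _ (by simp [Plant.P₂₂, transfer])
  rw [hY, hU] at hV
  generalize sensitivity P F L = S at *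
  generalize PowerSeries.mk w = W at *
  generalize PowerSeries.mk v = V at *
  have h1 : (1 - L.Lw * PowerSeries.X - P.P₂₂ * F.tf * L.Ly) * W =
      PowerSeries.mk r + L.Ly * transfer P.A (P.B₁ *ᵥ e) P.C₂ (P.D₂₁ ⬝ᵥ e) * PowerSeries.mk δ := by
    linear_combination hW + hV
  linear_combination S * h1 - W * hinv - hW

theorem noiseImpulse_zero : noiseImpulse P F L 0 = 0 := by
  simp [noiseImpulse, sensitivity, Plant.P₂₂, transfer]

theorem noiseImpulse_succ (n : ℕ) :
    noiseImpulse P F L (n + 1) = signalOp P L ((closedLoopOp P F L ^ n) (noiseDir P F)) := by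
  have h := mk_loopSignal P F L 0 0 (fun m => if m = 0 then 1 else 0)
  have hr : PowerSeries.mk (fun m : ℕ => if m = 0 then (1 : ℝ) else 0) = 1 := by
    ext n; simp [PowerSeries.coeff_one]
  have h0 : (PowerSeries.mk (0 : ℕ → ℝ)) = 0 := by ext n; simp
  rw [hr, h0, mul_one, mul_zero, add_zero] at h
  rw [noiseImpulse, ← h, PowerSeries.coeff_mk, loopSignal, encoderOutput_eq, toVec_loopState,
    LoopState.toVec_ofVec, Finset.sum_eq_single n]
  · simp
  · intro k hk hkn
    have : n - k ≠ 0 := by have := Finset.mem_range.1 hk; omega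
    simp [this]
  · simp

theorem disturbanceImpulse_eq (j : Fin nd) (n : ℕ) :
    disturbanceImpulse P F L j n = loopSignal P F L (.ofVec 0 : LoopState nx nf nl)
      (fun m => (if m = 0 then (1 : ℝ) else 0) • Pi.single j 1)
      (fun m v => v + (0 : ℕ → ℝ) m) n := by
  have h := mk_loopSignal P F L (Pi.single j 1) (fun m => if m = 0 then 1 else 0) 0
  have hr : PowerSeries.mk (fun m : ℕ => if m = 0 then (1 : ℝ) else 0) = 1 := by
    ext n; simp [PowerSeries.coeff_one]
  have h0 : (PowerSeries.mk (0 : ℕ → ℝ)) = 0 := by ext n; simp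
  have hP : transfer P.A (P.B₁ *ᵥ Pi.single j 1) P.C₂ (P.D₂₁ ⬝ᵥ Pi.single j 1) = P.P₂₁ j := by
    simp [Plant.P₂₁]
    rfl
  rw [hr, h0, mul_one, mul_zero, zero_add, hP] at h
  rw [disturbanceImpulse, ← h, PowerSeries.coeff_mk]

theorem disturbanceImpulse_zero (j : Fin nd) :
    disturbanceImpulse P F L j 0 = L.Dy * P.D₂₁ j := by
  rw [disturbanceImpulse_eq, loopSignal, encoderOutput_eq, toVec_loopState, LoopState.toVec_ofVec]
  simp

theorem disturbanceImpulse_succ (j : Fin nd) (n : ℕ) :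
    disturbanceImpulse P F L j (n + 1) =
      signalOp P L ((closedLoopOp P F L ^ n) (disturbanceOp P F L (Pi.single j 1))) := by
  rw [disturbanceImpulse_eq, loopSignal, encoderOutput_eq, toVec_loopState, LoopState.toVec_ofVec,
    Finset.sum_eq_single n]
  · simp
  · intro k hk hkn
    have : n - k ≠ 0 := by have := Finset.mem_range.1 hk; omega
    simp [this]
  · simp

/-- The encoder signal is the sum of the response to the initial state and of the convolutions of
the two inputs with the impulse responses. -/
theorem loopSignal_eq (s₀ : LoopState nx nf nl) (d : ℕ → Fin nd → ℝ) (r : ℕ → ℝ) (n : ℕ) :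
    loopSignal P F L s₀ d (fun m v => v + r m) n =
      signalOp P L ((closedLoopOp P F L ^ n) s₀.toVec) +
        ∑ k ∈ Finset.range (n + 1), (noiseImpulse P F L k * r (n - k) +
          ∑ j, disturbanceImpulse P F L j k * d (n - k) j) := by
  have hd : ∀ m, disturbanceOp P F L (d m) =
      ∑ j, d m j • disturbanceOp P F L (Pi.single j 1) := fun m => by
    conv_lhs => rw [pi_eq_sum_univ' (d m)]
    simp [map_sum]
  rw [loopSignal, encoderOutput_eq, toVec_loopState, map_add, add_assoc, Finset.sum_range_succ']
  congr 2
  · rw [map_sum]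
    refine Finset.sum_congr rfl fun k _ => ?_
    rw [noiseImpulse_succ, show n - 1 - k = n - (k + 1) by omega, hd]
    simp [disturbanceImpulse_succ, map_add, map_sum, mul_comm, add_comm]
  · simp [noiseImpulse_zero, disturbanceImpulse_zero, dotProduct, Finset.mul_sum, mul_assoc]

theorem abs_signalOp_pow_le (n : ℕ) (x : LoopVec nx nf nl) :
    |signalOp P L ((closedLoopOp P F L ^ n) x)| ≤
      ‖(signalOp P L : LoopVec nx nf nl →L[ℝ] ℝ)‖ * ‖closedLoopOp P F L ^ n‖ * ‖x‖ := by
  rw [mul_assoc]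
  exact ((signalOp P L).le_opNorm _).trans
    (mul_le_mul_of_nonneg_left (ContinuousLinearMap.le_opNorm _ _) (norm_nonneg _))

theorem summable_sq_of_le_mul {f a : ℕ → ℝ} (ha : Summable a) (c : ℝ)
    (h : ∀ n, |f (n + 1)| ≤ c * a n) : Summable fun n => f n ^ 2 := by
  have hf : Summable fun n => |f n| :=
    (summable_nat_add_iff 1).1 ((ha.mul_left c).of_nonneg_of_le (fun _ => abs_nonneg _) h)
  refine hf.of_norm_bounded_eventually_nat ?_
  filter_upwards [hf.tendsto_atTop_zero.eventually_le_const one_pos] with n hn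
  rw [norm_pow, Real.norm_eq_abs]
  exact pow_le_of_le_one (abs_nonneg _) hn two_ne_zero

theorem InternallyStable.summable_noiseImpulse_sq {P : Plant nx nd ne} {F : DecoderFilter nf}
    {L : EncoderFilter nl} (h : InternallyStable P F L) :
    Summable fun n => noiseImpulse P F L n ^ 2 := by
  refine summable_sq_of_le_mul h.summable_norm_pow
    (‖(signalOp P L : LoopVec nx nf nl →L[ℝ] ℝ)‖ * ‖(noiseDir P F : LoopVec nx nf nl)‖) fun n => ?_
  rw [noiseImpulse_succ, mul_right_comm]
  exact abs_signalOp_pow_le P F L n _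

theorem InternallyStable.summable_disturbanceImpulse_sq {P : Plant nx nd ne}
    {F : DecoderFilter nf} {L : EncoderFilter nl} (h : InternallyStable P F L) (j : Fin nd) :
    Summable fun n => disturbanceImpulse P F L j n ^ 2 := by
  refine summable_sq_of_le_mul h.summable_norm_pow
    (‖(signalOp P L : LoopVec nx nf nl →L[ℝ] ℝ)‖ *
      ‖disturbanceOp P F L (Pi.single j 1)‖) fun n => ?_
  rw [disturbanceImpulse_succ, mul_right_comm]
  exact abs_signalOp_pow_le P F L n _

end Loop

/-! ### Second moments of random signals -/

section Moments

variable {Ω : Type*} [MeasurableSpace Ω] {μ : Measure Ω}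

/-- The Cauchy–Schwarz inequality for the covariance. -/
theorem sq_covariance_le [IsFiniteMeasure μ] {X Y : Ω → ℝ} (hX : MemLp X 2 μ) (hY : MemLp Y 2 μ) :
    cov[X, Y; μ] ^ 2 ≤ Var[X; μ] * Var[Y; μ] := by
  have h := discrim_le_zero (a := Var[X; μ]) (b := 2 * cov[X, Y; μ]) (c := Var[Y; μ]) fun t => by
    have := variance_nonneg (t • X + Y) μ
    rw [variance_add (hX.const_smul t) hY, variance_smul, covariance_smul_left] at this
    linarith
  rw [discrim] at h
  linarith

/-- A perturbation whose variance vanishes in the limit, correlated or not, does not change the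
limit of the variance. -/
theorem tendsto_variance_add [IsFiniteMeasure μ] {X Y : ℕ → Ω → ℝ} {c : ℝ}
    (hX : ∀ n, MemLp (X n) 2 μ) (hY : ∀ n, MemLp (Y n) 2 μ)
    (hX0 : Tendsto (fun n => Var[X n; μ]) atTop (𝓝 0))
    (hYc : Tendsto (fun n => Var[Y n; μ]) atTop (𝓝 c)) :
    Tendsto (fun n => Var[X n + Y n; μ]) atTop (𝓝 c) := by
  have hcov : Tendsto (fun n => cov[X n, Y n; μ]) atTop (𝓝 0) := by
    have h2 : Tendsto (fun n => cov[X n, Y n; μ] ^ 2) atTop (𝓝 0) :=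
      squeeze_zero (fun n => sq_nonneg _) (fun n => sq_covariance_le (hX n) (hY n))
        (by simpa using hX0.mul hYc)
    have h3 := h2.sqrt
    simp only [Real.sqrt_sq_eq_abs, Real.sqrt_zero] at h3
    exact (tendsto_zero_iff_abs_tendsto_zero _).2 h3
  simp_rw [fun n => variance_add (hX n) (hY n)]
  simpa using (hX0.add (hcov.const_mul 2)).add hYc

/-- Pythagoras: the variance of a linear combination of uncorrelated variables. -/
theorem variance_sum_of_uncorrelated [IsFiniteMeasure μ] {ι : Type*} [DecidableEq ι]
    {X : ι → Ω → ℝ} (hX : ∀ i, MemLp (X i) 2 μ) {c : ι → ℝ}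
    (hcov : ∀ i j, cov[X i, X j; μ] = if i = j then c i else 0) (s : Finset ι) (a : ι → ℝ) :
    Var[fun ω => ∑ i ∈ s, a i * X i ω; μ] = ∑ i ∈ s, a i ^ 2 * c i := by
  rw [variance_fun_sum' fun i _ => (hX i).const_mul (a i)]
  refine Finset.sum_congr rfl fun i hi => ?_
  simp only [covariance_const_mul_left, covariance_const_mul_right, hcov]
  rw [Finset.sum_eq_single i (fun j _ hj => by simp [hj.symm]) (fun h => absurd hi h), if_pos rfl]
  ring

/-- A convolution with summable operator coefficients of a process that is bounded in mean square is
bounded in mean square: by the Cauchy–Schwarz inequality with weights `‖T k‖`, the squared norm of the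
sum is at most `∑ ‖T k‖` times the weighted sum of the squared norms, pathwise. -/
theorem integral_sq_norm_convolution_le {E : Type*} [NormedAddCommGroup E] [NormedSpace ℝ E]
    {T : ℕ → E →L[ℝ] E} (hT : Summable fun n => ‖T n‖) {g : ℕ → Ω → E}
    (hg : ∀ n, MemLp (g n) 2 μ) {K : ℝ} (hK : ∀ n, ∫ ω, ‖g n ω‖ ^ 2 ∂μ ≤ K) (n : ℕ) :
    ∫ ω, ‖∑ k ∈ Finset.range (n + 1), T k (g (n - k) ω)‖ ^ 2 ∂μ ≤ (∑' k, ‖T k‖) ^ 2 * K := by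
  have hint : ∀ m, Integrable (fun ω => ‖g m ω‖ ^ 2) μ := fun m =>
    (hg m).integrable_norm_pow two_ne_zero
  have hK0 : 0 ≤ K := (integral_nonneg fun ω => by positivity).trans (hK 0)
  set s := Finset.range (n + 1)
  have hs : ∑ k ∈ s, ‖T k‖ ≤ ∑' k, ‖T k‖ := hT.sum_le_tsum _ fun _ _ => norm_nonneg _
  have hs0 : 0 ≤ ∑ k ∈ s, ‖T k‖ := Finset.sum_nonneg fun _ _ => norm_nonneg _
  have hpt : ∀ ω, ‖∑ k ∈ s, T k (g (n - k) ω)‖ ^ 2 ≤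
      (∑ k ∈ s, ‖T k‖) * ∑ k ∈ s, ‖T k‖ * ‖g (n - k) ω‖ ^ 2 := fun ω => by
    calc ‖∑ k ∈ s, T k (g (n - k) ω)‖ ^ 2 ≤ (∑ k ∈ s, ‖T k‖ * ‖g (n - k) ω‖) ^ 2 := by
          gcongr
          exact norm_sum_le_of_le _ fun k _ => (T k).le_opNorm _
      _ ≤ _ := Finset.sum_sq_le_sum_mul_sum_of_sq_le_mul s (fun _ _ => norm_nonneg _)
          (fun _ _ => by positivity) (fun _ _ => le_of_eq (by ring))
  have hi : Integrable (fun ω => (∑ k ∈ s, ‖T k‖) * ∑ k ∈ s, ‖T k‖ * ‖g (n - k) ω‖ ^ 2) μ :=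
    (integrable_finsetSum s fun k _ => (hint (n - k)).const_mul ‖T k‖).const_mul _
  calc ∫ ω, ‖∑ k ∈ s, T k (g (n - k) ω)‖ ^ 2 ∂μ
      ≤ ∫ ω, (∑ k ∈ s, ‖T k‖) * ∑ k ∈ s, ‖T k‖ * ‖g (n - k) ω‖ ^ 2 ∂μ :=
        integral_mono_of_nonneg (.of_forall fun _ => by positivity) hi (.of_forall hpt)
    _ = (∑ k ∈ s, ‖T k‖) * ∑ k ∈ s, ‖T k‖ * ∫ ω, ‖g (n - k) ω‖ ^ 2 ∂μ := by
        rw [integral_const_mul, integral_finsetSum s fun k _ => (hint (n - k)).const_mul _]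
        simp_rw [integral_const_mul]
    _ ≤ (∑ k ∈ s, ‖T k‖) * ∑ k ∈ s, ‖T k‖ * K := by
        gcongr with k
        exact hK _
    _ = (∑ k ∈ s, ‖T k‖) ^ 2 * K := by rw [← Finset.sum_mul]; ring
    _ ≤ _ := by gcongr

end Moments

/-! ### The loop driven by white noise -/

section Driven

variable {nx nd ne nf nl : ℕ} {Ω : Type*} [MeasurableSpace Ω]

/-- The second-order content of the inputs of a loop: a square-integrable initial state, a white
disturbance with identity covariance, and a white channel noise of variance `τ` that is uncorrelated
with the disturbance. The initial state may be correlated with both. -/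
structure WhiteInputs (μ : Measure Ω) (s₀ : Ω → LoopState nx nf nl) (d : ℕ → Ω → Fin nd → ℝ)
    (r : ℕ → Ω → ℝ) (τ : ℝ) : Prop where
  init_memLp : MemLp (fun ω => (s₀ ω).toVec) 2 μ
  dist_memLp : ∀ n j, MemLp (fun ω => d n ω j) 2 μ
  noise_memLp : ∀ n, MemLp (r n) 2 μ
  dist_cov : ∀ m n i j, cov[fun ω => d m ω i, fun ω => d n ω j; μ] = if m = n ∧ i = j then 1 else 0
  noise_cov : ∀ m n, cov[r m, r n; μ] = if m = n then τ else 0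
  cross_cov : ∀ m n j, cov[r m, fun ω => d n ω j; μ] = 0
  dist_sq : ∀ n j, ∫ ω, d n ω j ^ 2 ∂μ = 1
  noise_sq : ∀ n, ∫ ω, r n ω ^ 2 ∂μ = τ

variable {P : Plant nx nd ne} {F : DecoderFilter nf} {L : EncoderFilter nl} {μ : Measure Ω}
  {s₀ : Ω → LoopState nx nf nl} {d : ℕ → Ω → Fin nd → ℝ}
  {r : ℕ → Ω → ℝ} {τ : ℝ}

/-- The variance of the response of `v` to the two inputs converges. -/
theorem WhiteInputs.tendsto_variance_forced [IsProbabilityMeasure μ] (hst : InternallyStable P F L)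
    (h : WhiteInputs μ s₀ d r τ) :
    Tendsto (fun n => Var[fun ω => ∑ k ∈ Finset.range (n + 1), (noiseImpulse P F L k * r (n - k) ω +
        ∑ j, disturbanceImpulse P F L j k * d (n - k) ω j); μ]) atTop
      (𝓝 (minSNR P F L * τ + disturbanceGain P F L)) := by
  -- Both inputs are indexed together; `none` stands for the channel noise.
  let X : ℕ × Option (Fin nd) → Ω → ℝ := fun p => p.2.elim (r p.1) (fun j ω => d p.1 ω j)
  let c : ℕ × Option (Fin nd) → ℝ := fun p => p.2.elim τ (fun _ => 1)
  let a : ℕ → Option (Fin nd) → ℝ :=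
    fun k i => i.elim (noiseImpulse P F L k) (fun j => disturbanceImpulse P F L j k)
  have hX : ∀ p, MemLp (X p) 2 μ := by
    rintro ⟨n, _ | j⟩
    exacts [h.noise_memLp n, h.dist_memLp n j]
  have hcov : ∀ p p', cov[X p, X p'; μ] = if p = p' then c p else 0 := by
    rintro ⟨m, _ | i⟩ ⟨n, _ | j⟩
    · simpa [X, c] using h.noise_cov m n
    · simpa [X, c] using h.cross_cov m n j
    · simpa [X, c, covariance_comm] using h.cross_cov n m i
    · simpa [X, c] using h.dist_cov m n i j
  have hvar : ∀ n, Var[fun ω => ∑ k ∈ Finset.range (n + 1), (noiseImpulse P F L k * r (n - k) ω +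
        ∑ j, disturbanceImpulse P F L j k * d (n - k) ω j); μ] =
      ∑ k ∈ Finset.range (n + 1), (noiseImpulse P F L k ^ 2 * τ +
        ∑ j, disturbanceImpulse P F L j k ^ 2) := fun n => by
    have := variance_sum_of_uncorrelated hX hcov (Finset.range (n + 1) ×ˢ Finset.univ)
      (fun p => a (n - p.1) p.2)
    simp only [Finset.sum_product, Fintype.sum_option] at this
    -- The time index is reversed so that the inputs `r k`, `d k` carry the summation index.
    have hrefl : ∀ f : ℕ → ℕ → ℝ, ∑ k ∈ Finset.range (n + 1), f k (n - k) =
        ∑ k ∈ Finset.range (n + 1), f (n - k) k := fun f => by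
      rw [← Finset.sum_range_reflect]
      refine Finset.sum_congr rfl fun k hk => ?_
      have := Finset.mem_range.1 hk
      rw [show n + 1 - 1 - k = n - k by omega, show n - (n - k) = k by omega]
    have hL : ∀ ω, ∑ k ∈ Finset.range (n + 1), (noiseImpulse P F L k * r (n - k) ω +
        ∑ j, disturbanceImpulse P F L j k * d (n - k) ω j) = _ := fun ω =>
      hrefl fun k m => noiseImpulse P F L k * r m ω + ∑ j, disturbanceImpulse P F L j k * d m ω j
    have hR := hrefl fun k _ => noiseImpulse P F L k ^ 2 * τ + ∑ j, disturbanceImpulse P F L j k ^ 2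
    simp_rw [hL, hR]
    simpa [X, c, a] using this
  simp_rw [hvar]
  have hs : HasSum (fun k => noiseImpulse P F L k ^ 2 * τ + ∑ j, disturbanceImpulse P F L j k ^ 2)
      (minSNR P F L * τ + disturbanceGain P F L) :=
    (hst.summable_noiseImpulse_sq.hasSum.mul_right τ).add
      (hasSum_sum fun j _ => (hst.summable_disturbanceImpulse_sq j).hasSum)
  exact hs.tendsto_sum_nat.comp (tendsto_add_atTop_nat 1)

/-- The influence of the initial state on the encoder signal dies out in mean square. -/
theorem WhiteInputs.tendsto_variance_free [IsProbabilityMeasure μ] (hst : InternallyStable P F L)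
    (h : WhiteInputs μ s₀ d r τ) :
    Tendsto (fun n => Var[fun ω => signalOp P L ((closedLoopOp P F L ^ n) (s₀ ω).toVec); μ])
      atTop (𝓝 0) := by
  have hA := hst.summable_norm_pow.tendsto_atTop_zero
  have hlim : Tendsto (fun n => (‖(signalOp P L : LoopVec nx nf nl →L[ℝ] ℝ)‖ *
      ‖closedLoopOp P F L ^ n‖) ^ 2 * ∫ ω, ‖(s₀ ω).toVec‖ ^ 2 ∂μ) atTop (𝓝 0) := by
    simpa using ((hA.const_mul _).pow 2).mul_const _
  refine squeeze_zero (fun n => variance_nonneg _ _) (fun n => ?_) hlim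
  have hm : MemLp (fun ω => signalOp P L ((closedLoopOp P F L ^ n) (s₀ ω).toVec)) 2 μ :=
    ((signalOp P L).comp (closedLoopOp P F L ^ n)).comp_memLp' h.init_memLp
  refine (variance_le_expectation_sq hm.1).trans ?_
  rw [← integral_const_mul]
  refine integral_mono_of_nonneg (.of_forall fun _ => sq_nonneg _)
    ((h.init_memLp.integrable_norm_pow two_ne_zero).const_mul _) (.of_forall fun ω => ?_)
  simp only [Pi.pow_apply]
  rw [← mul_pow, ← sq_abs]
  gcongr
  exact abs_signalOp_pow_le P F L n _

/-- The steady-state variance of the encoder signal is `‖S - 1‖² τ + ‖L_y P₂₁ S‖²`. -/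
theorem WhiteInputs.tendsto_variance_loopSignal [IsProbabilityMeasure μ]
    (hst : InternallyStable P F L) (h : WhiteInputs μ s₀ d r τ) :
    Tendsto (fun n => Var[fun ω =>
        loopSignal P F L (s₀ ω) (fun m => d m ω) (fun m v => v + r m ω) n; μ]) atTop
      (𝓝 (minSNR P F L * τ + disturbanceGain P F L)) := by
  simp_rw [loopSignal_eq]
  refine tendsto_variance_add (fun n => ?_) (fun n => ?_) (h.tendsto_variance_free hst)
    (h.tendsto_variance_forced hst)
  · exact ((signalOp P L).comp (closedLoopOp P F L ^ n)).comp_memLp' h.init_memLp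
  · exact memLp_finsetSum _ fun k _ => ((h.noise_memLp _).const_mul _).add
      (memLp_finsetSum _ fun j _ => (h.dist_memLp _ j).const_mul _)

/-- The plant of an internally stable loop with white inputs is mean-square stable. -/
theorem WhiteInputs.meanSquareStable (hst : InternallyStable P F L)
    (h : WhiteInputs μ s₀ d r τ) :
    MeanSquareStable μ fun n ω =>
      (loopState P F L (s₀ ω) (fun m => d m ω) (fun m v => v + r m ω) n).plant := by
  have hd : ∀ n, MemLp (d n) 2 μ := fun n => memLp_pi_iff.2 (h.dist_memLp n)
  -- The initial state is treated as the input at time `0`, the other inputs are delayed by one.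
  let g : ℕ → Ω → LoopVec nx nf nl := fun n ω => match n with
    | 0 => (s₀ ω).toVec
    | n + 1 => disturbanceOp P F L (d n ω) + r n ω • noiseDir P F
  have hX : ∀ n ω, (loopState P F L (s₀ ω) (fun m => d m ω) (fun m v => v + r m ω) n).toVec =
      ∑ k ∈ Finset.range (n + 1), (closedLoopOp P F L ^ k) (g (n - k) ω) := fun n ω => by
    rw [toVec_loopState, Finset.sum_range_succ, add_comm]
    congr 1
    · refine Finset.sum_congr rfl fun k hk => ?_
      obtain ⟨m, hm⟩ : ∃ m, n - k = m + 1 := ⟨n - k - 1, by have := Finset.mem_range.1 hk; omega⟩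
      rw [hm, show n - 1 - k = m by omega]
    · simp [g]
  have hg : ∀ n, MemLp (g n) 2 μ := by
    rintro (_ | n)
    · exact h.init_memLp
    · exact ((disturbanceOp P F L).comp_memLp' (hd n)).add 
        ((ContinuousLinearMap.toSpanSingleton ℝ (noiseDir P F : LoopVec nx nf nl)).comp_memLp'
          (h.noise_memLp n))
  set K₁ : ℝ := 2 * (‖(disturbanceOp P F L : _ →L[ℝ] LoopVec nx nf nl)‖ ^ 2 * nd +
    ‖(noiseDir P F : LoopVec nx nf nl)‖ ^ 2 * τ)
  have hK₁ : ∀ n, ∫ ω, ‖g (n + 1) ω‖ ^ 2 ∂μ ≤ K₁ := fun n => by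
    have hdi : Integrable (fun ω => ∑ j, d n ω j ^ 2) μ :=
      integrable_finsetSum _ fun j _ => (h.dist_memLp n j).integrable_sq
    have hri := (h.noise_memLp n).integrable_sq
    have hpt : ∀ ω, ‖g (n + 1) ω‖ ^ 2 ≤
        2 * (‖(disturbanceOp P F L : _ →L[ℝ] LoopVec nx nf nl)‖ ^ 2 * ∑ j, d n ω j ^ 2 +
          ‖(noiseDir P F : LoopVec nx nf nl)‖ ^ 2 * r n ω ^ 2) := fun ω => by
      have h1 : ‖d n ω‖ ^ 2 ≤ ∑ j, d n ω j ^ 2 := by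
        have h0 : (0 : ℝ) ≤ ∑ j, d n ω j ^ 2 := Finset.sum_nonneg fun _ _ => sq_nonneg _
        rw [← Real.le_sqrt (norm_nonneg _) h0]
        refine (pi_norm_le_iff_of_nonneg (Real.sqrt_nonneg _)).2 fun j => Real.abs_le_sqrt ?_
        exact Finset.single_le_sum (f := fun j => d n ω j ^ 2) (fun _ _ => sq_nonneg _)
          (Finset.mem_univ j)
      calc ‖g (n + 1) ω‖ ^ 2 ≤ (‖(disturbanceOp P F L : _ →L[ℝ] LoopVec nx nf nl)‖ * ‖d n ω‖ +
            |r n ω| * ‖(noiseDir P F : LoopVec nx nf nl)‖) ^ 2 := by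
            gcongr
            refine norm_add_le_of_le (ContinuousLinearMap.le_opNorm _ _) ?_
            rw [norm_smul, Real.norm_eq_abs]
        _ ≤ 2 * ((‖(disturbanceOp P F L : _ →L[ℝ] LoopVec nx nf nl)‖ * ‖d n ω‖) ^ 2 +
            (|r n ω| * ‖(noiseDir P F : LoopVec nx nf nl)‖) ^ 2) := add_sq_le
        _ ≤ _ := by
            rw [mul_pow, mul_pow, sq_abs, mul_comm (r n ω ^ 2)]
            gcongr
    have hi : Integrable (fun ω =>
        ‖(disturbanceOp P F L : _ →L[ℝ] LoopVec nx nf nl)‖ ^ 2 * ∑ j, d n ω j ^ 2 +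
          ‖(noiseDir P F : LoopVec nx nf nl)‖ ^ 2 * r n ω ^ 2) μ :=
      (hdi.const_mul _).add (hri.const_mul _)
    refine (integral_mono_of_nonneg (.of_forall fun _ => by positivity)
      (hi.const_mul 2) (.of_forall hpt)).trans_eq ?_
    rw [integral_const_mul, integral_add (hdi.const_mul _) (hri.const_mul _), integral_const_mul,
      integral_const_mul, integral_finsetSum _ fun j _ => (h.dist_memLp n j).integrable_sq]
    simp [h.dist_sq, h.noise_sq, K₁]
  set K := max (∫ ω, ‖(s₀ ω).toVec‖ ^ 2 ∂μ) K₁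
  have hK : ∀ n, ∫ ω, ‖g n ω‖ ^ 2 ∂μ ≤ K := by
    rintro (_ | n)
    exacts [le_max_left _ _, (hK₁ n).trans (le_max_right _ _)]
  have hXm : ∀ n, MemLp (fun ω =>
      (loopState P F L (s₀ ω) (fun m => d m ω) (fun m v => v + r m ω) n).toVec) 2 μ := fun n => by
    simp_rw [hX]
    exact memLp_finsetSum _ fun k _ => (closedLoopOp P F L ^ k).comp_memLp' (hg _)
  refine ⟨fun n i => memLp_pi_iff.1 (hXm n).fst i, (∑' k, ‖closedLoopOp P F L ^ k‖) ^ 2 * K,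
    fun n i j => ?_⟩
  have hb := integral_sq_norm_convolution_le hst.summable_norm_pow hg hK n
  simp_rw [← hX] at hb
  refine (abs_integral_le_integral_abs.trans ?_).trans hb
  refine integral_mono_of_nonneg (.of_forall fun _ => abs_nonneg _)
    ((hXm n).integrable_norm_pow two_ne_zero) (.of_forall fun ω => ?_)
  have hle : ∀ i, |(loopState P F L (s₀ ω) (fun m => d m ω) (fun m v => v + r m ω) n).plant i| ≤
      ‖(loopState P F L (s₀ ω) (fun m => d m ω) (fun m v => v + r m ω) n).toVec‖ := fun i =>
    (norm_le_pi_norm _ i).trans (norm_fst_le (LoopState.toVec _))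
  simp only [abs_mul, sq]
  exact mul_le_mul (hle i) (hle j) (abs_nonneg _) (norm_nonneg _)

end Driven

/-! ### Averages of independent descriptions -/

section Descriptions

variable {nx nd nf nl : ℕ} {Ω : Type*}

/-- The noise in the average of the descriptions with index in `I`. -/
noncomputable def averageNoise {k : ℕ} (q : Fin k → ℕ → Ω → ℝ) (I : Finset (Fin k)) (n : ℕ)
    (ω : Ω) : ℝ :=
  (∑ i ∈ I, q i n ω) / (I.card : ℝ)

theorem received_eq {k : ℕ} (q : Fin k → ℕ → Ω → ℝ) {I : Finset (Fin k)} (hI : I.card ≠ 0) (n : ℕ)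
    (ω : Ω) (v : ℝ) : received q I n ω v = v + averageNoise q I n ω := by
  have : (I.card : ℝ) ≠ 0 := by exact_mod_cast hI
  simp only [received, description, averageNoise, Finset.sum_add_distrib, Finset.sum_const,
    nsmul_eq_mul]
  field_simp

variable [MeasurableSpace Ω] {μ : Measure Ω}

/-- Averaging `k'` independent white noises divides the variance by `k'`, and whiteness persists when
the averaged indices vary with time. -/
theorem whiteNoise_averageNoise [IsProbabilityMeasure μ] {k k' : ℕ} (hk' : 1 ≤ k')
    {q : Fin k → ℕ → Ω → ℝ} {σ2 : ℝ}
    (hq : ∀ i, WhiteNoise μ (q i) σ2) (hind : iIndepFun (fun i ω n => q i n ω) μ)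
    {I : ℕ → Finset (Fin k)} (hI : ∀ n, (I n).card = k') :
    WhiteNoise μ (fun n => averageNoise q (I n) n) (σ2 / k') := by
  have hk0 : (k' : ℝ) ≠ 0 := by exact_mod_cast (by omega : k' ≠ 0)
  have hint : ∀ i j m n, Integrable (fun ω => q i m ω * q j n ω) μ := fun i j m n =>
    ((hq i).memLp m).integrable_mul ((hq j).memLp n)
  have hmom : ∀ i j m n, ∫ ω, q i m ω * q j n ω ∂μ =
      if i = j then if m = n then σ2 else 0 else 0 := by
    intro i j m n
    split_ifs with hij hmn
    · subst hij hmn; simpa using (hq i).white m m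
    · subst hij; simpa [hmn] using (hq i).white m n
    · have : IndepFun (q i m) (q j n) μ :=
        (hind.indepFun hij).comp (measurable_pi_apply m) (measurable_pi_apply n)
      rw [this.integral_fun_mul_eq_mul_integral ((hq i).memLp m).1 ((hq j).memLp n).1,
        (hq i).mean_zero, zero_mul]
  refine ⟨fun n => ?_, fun n => ?_, fun m n => ?_⟩
  · exact (memLp_finsetSum (I n) fun i _ => (hq i).memLp n).mul_const ((I n).card : ℝ)⁻¹
  · simp only [averageNoise]
    rw [integral_div]
    rw [integral_finsetSum _ fun i _ => ((hq i).memLp n).integrable one_le_two]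
    simp [(hq _).mean_zero]
  · simp only [averageNoise, hI, div_mul_div_comm, Finset.sum_mul_sum]
    rw [integral_div, integral_finsetSum _ fun i _ => integrable_finsetSum _ fun j _ => hint i j m n]
    simp_rw [integral_finsetSum _ fun j _ => hint _ j m n, hmom]
    by_cases hmn : m = n
    · subst hmn
      simp [hI]
      field_simp
    · simp [hmn]

theorem WhiteNoise.covariance_eq [IsProbabilityMeasure μ] {r : ℕ → Ω → ℝ} {τ : ℝ}
    (hr : WhiteNoise μ r τ) (m n : ℕ) : cov[r m, r n; μ] = if m = n then τ else 0 := by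
  rw [covariance_eq_sub (hr.memLp m) (hr.memLp n), hr.mean_zero, zero_mul, sub_zero]
  exact hr.white m n

theorem WhiteNoise.variance_eq [IsProbabilityMeasure μ] {r : ℕ → Ω → ℝ} {τ : ℝ}
    (hr : WhiteNoise μ r τ) (n : ℕ) : Var[r n; μ] = τ := by
  rw [← covariance_self (hr.memLp n).1.aemeasurable, hr.covariance_eq, if_pos rfl]

/-- The inputs of the loop are white in the second-order sense if the initial state and the
disturbance are Gaussian and the channel noise is uncorrelated with the disturbance. -/
theorem GaussianSources.whiteInputs [IsProbabilityMeasure μ] {s₀ : Ω → LoopState nx nf nl}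
    {d : ℕ → Ω → Fin nd → ℝ} {r : ℕ → Ω → ℝ} {τ : ℝ}
    (hs : GaussianSources μ (fun ω => (s₀ ω).plant) d)
    (hf : ∃ (f₀ : Fin nf → ℝ) (l₀ : Fin nl → ℝ) (w₀ : ℝ), ∀ ω,
      (s₀ ω).dec = f₀ ∧ (s₀ ω).enc = l₀ ∧ (s₀ ω).wPrev = w₀)
    (hr : WhiteNoise μ r τ) (hrd : ∀ m n j, cov[r m, fun ω => d n ω j; μ] = 0) :
    WhiteInputs μ s₀ d r τ := by
  have hd : ∀ n j, MemLp (fun ω => d n ω j) 2 μ := fun n j =>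
    (hs.gaussian.hasGaussianLaw_eval (Sum.inr (n, j))).memLp_two
  obtain ⟨f₀, l₀, w₀, hf⟩ := hf
  refine ⟨?_, hd, hr.memLp, fun m n i j => ?_, hr.covariance_eq, hrd, fun n j => ?_, fun n => ?_⟩
  · have : (fun ω => (s₀ ω).toVec) = fun ω => ((s₀ ω).plant, f₀, l₀, w₀) := by
      funext ω
      obtain ⟨h1, h2, h3⟩ := hf ω
      rw [LoopState.toVec, h1, h2, h3]
    rw [this]
    refine memLp_prod_iff.2 ⟨memLp_pi_iff.2 fun i => ?_, memLp_const _⟩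
    exact (hs.gaussian.hasGaussianLaw_eval (Sum.inl i)).memLp_two
  · rw [covariance_eq_sub (hd m i) (hd n j), hs.mean_zero, zero_mul, sub_zero]
    exact hs.white m n i j
  · simpa [sq] using hs.white n n j j
  · simpa [sq] using hr.white n n

end Descriptions

theorem lemma1 {nx nd ne nf nl : ℕ}
    (P : Plant nx nd ne) (F : DecoderFilter nf) (L : EncoderFilter nl) (γ : ℝ)
    {Ω : Type*} [MeasurableSpace Ω] (μ : Measure Ω) [IsProbabilityMeasure μ]
    (s₀ : Ω → LoopState nx nf nl) (d : ℕ → Ω → Fin nd → ℝ)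
    (q₀ : ℕ → Ω → ℝ) (σv2 σq2 : ℝ)
    (hsys : IsLinearSystem P F L γ μ s₀ d q₀ σv2 σq2)
    (hS : sensitivity P F L ≠ 1) (hγ : minSNR P F L < γ)
    (k k' : ℕ) (hk' : 1 ≤ k') (hk : k' ≤ k)
    (q : Fin k → ℕ → Ω → ℝ) (σ2 : ℝ) (hσ : 0 < σ2)
    (hq : ∀ i, WhiteNoise μ (q i) σ2)
    (hq_indep : iIndepFun (fun i ω n => q i n ω) μ)
    (hq_sources : IndepFun (fun ω => ((s₀ ω).plant, fun n => d n ω)) (fun ω i n => q i n ω) μ)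
    (hbound : σ2 ≤ γ * k' * disturbanceGain P F L / (minSNR P F L * (γ - minSNR P F L))) :
    -- any `k'` descriptions stabilize the system
    IsStabilizingCode P F L k' μ s₀ d q ∧
    -- the SNR of the average of any `k'` descriptions of the signal `v` of `(F, L, P, γ)`
    (∀ (I : Finset (Fin k)) (n : ℕ), I.card = k' →
      let v : Ω → ℝ := fun ω =>
        loopSignal P F L (s₀ ω) (fun m => d m ω) (fun m x => x + q₀ m ω) n
      let noise : Ω → ℝ := fun ω => received q I n ω (v ω) - v ω
      0 < Var[noise; μ] ∧
      minSNR P F L ≤ σv2 / Var[noise; μ] ∧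
      (σ2 < γ * k' * disturbanceGain P F L / (minSNR P F L * (γ - minSNR P F L)) →
        minSNR P F L < σv2 / Var[noise; μ])) ∧
    -- the steady-state SNR of the loop that is closed over `k'` descriptions
    (∀ I : ℕ → Finset (Fin k), (∀ n, (I n).card = k') →
      ∃ σ'v2 : ℝ,
        Tendsto (fun n => Var[codedSignal P F L s₀ d q I n; μ]) atTop (𝓝 σ'v2) ∧
        ∀ n, minSNR P F L < σ'v2 /
          Var[fun ω => received q (I n) n ω (codedSignal P F L s₀ d q I n ω)
            - codedSignal P F L s₀ d q I n ω; μ]) := by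
  have hk0 : (0 : ℝ) < k' := by exact_mod_cast hk'
  have hτ : 0 < σ2 / k' := div_pos hσ hk0
  have hdist : ∀ n j, Measurable fun p : (Fin nx → ℝ) × (ℕ → Fin nd → ℝ) => p.2 n j := by
    intro n j; fun_prop
  -- The loop of `(F, L, P, γ)` fixes the gain of the disturbance: `γ = ‖S - 1‖² + gain / σq2`.
  have hin₀ : WhiteInputs μ s₀ d q₀ σq2 := by
    refine hsys.sources.whiteInputs hsys.filters_init hsys.noise_white fun m n j => ?_
    have hd : MemLp (fun ω => d n ω j) 2 μ :=
      (hsys.sources.gaussian.hasGaussianLaw_eval (Sum.inr (n, j))).memLp_two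
    have : IndepFun (fun ω => d n ω j) (q₀ m) μ :=
      hsys.noise_indep.comp (hdist n j) (measurable_pi_apply m)
    exact this.symm.covariance_eq_zero (hsys.noise_white.memLp m) hd
  have hσv : σv2 = minSNR P F L * σq2 + disturbanceGain P F L :=
    tendsto_nhds_unique hsys.steady_state (hin₀.tendsto_variance_loopSignal hsys.stable)
  have hq0 := hsys.noise_pos
  have hgain : disturbanceGain P F L = (γ - minSNR P F L) * σq2 := by
    rw [hsys.snr_eq, sub_mul, div_mul_cancel₀ _ hq0.ne', hσv]
    ring
  have hgain_pos : 0 < disturbanceGain P F L := hgain ▸ mul_pos (sub_pos.2 hγ) hq0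
  have hN : 0 < minSNR P F L := by
    obtain ⟨n, hn⟩ : ∃ n, noiseImpulse P F L n ≠ 0 := by
      by_contra! h
      exact hS (sub_eq_zero.1 (PowerSeries.ext h))
    exact hsys.stable.summable_noiseImpulse_sq.tsum_pos (fun _ => sq_nonneg _) n (by positivity)
  -- In terms of `σv2`, the bound reads `σ2 ≤ k' σv2 / ‖S - 1‖²`.
  have hrhs : γ * k' * disturbanceGain P F L / (minSNR P F L * (γ - minSNR P F L)) =
      k' * σv2 / minSNR P F L := by
    have h1 : γ - minSNR P F L ≠ 0 := (sub_pos.2 hγ).ne'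
    have h2 : σv2 = γ * σq2 := by rw [hsys.snr_eq, div_mul_cancel₀ _ hq0.ne']
    rw [hgain, h2]
    field_simp
  rw [hrhs] at hbound ⊢
  have hrec : ∀ I : Finset (Fin k), I.card = k' → ∀ n ω v,
      received q I n ω v = v + averageNoise q I n ω := fun I hI n ω v =>
    received_eq q (by omega) n ω v
  have hin : ∀ I : ℕ → Finset (Fin k), (∀ n, (I n).card = k') →
      WhiteInputs μ s₀ d (fun n => averageNoise q (I n) n) (σ2 / k') := fun I hI => by
    have hw := whiteNoise_averageNoise hk' hq hq_indep hI
    refine hsys.sources.whiteInputs hsys.filters_init hw fun m n j => ?_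
    have hm : Measurable fun p : Fin k → ℕ → ℝ => (∑ i ∈ I m, p i m) / ((I m).card : ℝ) := by
      fun_prop
    have : IndepFun (fun ω => d n ω j) (averageNoise q (I m) m) μ :=
      hq_sources.comp (hdist n j) hm
    exact this.symm.covariance_eq_zero (hw.memLp m) (hin₀.dist_memLp n j)
  have hvar : ∀ I : Finset (Fin k), I.card = k' → ∀ n, Var[averageNoise q I n; μ] = σ2 / k' :=
    fun I hI n =>
      (whiteNoise_averageNoise (I := fun _ => I) hk' hq hq_indep fun _ => hI).variance_eq n
  refine ⟨fun I hI => ?_, fun I n hI => ?_, fun I hI => ?_⟩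
  · have := (hin I hI).meanSquareStable (P := P) (F := F) (L := L) hsys.stable
    simpa only [codedState, hrec _ (hI _)] using this
  · simp only [hrec I hI, add_sub_cancel_left]
    rw [hvar I hI, le_div_iff₀ hτ, lt_div_iff₀ hτ, ← mul_div_assoc, div_le_iff₀ hk0,
      div_lt_iff₀ hk0]
    rw [le_div_iff₀ hN] at hbound
    refine ⟨hτ, by linarith, fun h => ?_⟩
    rw [lt_div_iff₀ hN] at h
    linarith
  · refine ⟨minSNR P F L * (σ2 / k') + disturbanceGain P F L, ?_, fun n => ?_⟩
    · have := (hin I hI).tendsto_variance_loopSignal (P := P) (F := F) (L := L) hsys.stable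
      unfold codedSignal
      simpa only [hrec _ (hI _)] using this
    · simp only [hrec _ (hI _), add_sub_cancel_left]
      rw [hvar _ (hI n), lt_div_iff₀ hτ]
      linarith
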